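/- Let $d \ge 1$ be an integer and $\ell \in \mathbb{R}$. On the interior $\{t > |x|\}$ of the forward light cone in Minkowski space $\mathbb{R}^{1,d}$, with standard coordinates $(t, x) = (t, x^1, \dots, x^d)$, let $L^i = t\,\partial_{x^i} + x^i\,\partial_t$ ($1 \le i \le d$) be the Lorentz boosts. For a finite sequence $\alpha = (\alpha_1, \dots, \alpha_m) \in \{1, \dots, d\}^m$ put $|\alpha| = m$ and $L^\alpha f = L^{\alpha_m} L^{\alpha_{m-1}} \cdots L^{\alpha_1} f$, with $L^\alpha f = f$ if $m = 0$. Use the coordinates $t = \tau \cosh\rho$, $x = \tau \sinh(\rho)\,\theta$ with $\tau > 0$, $\rho \ge 0$, $\theta \in \mathbb{S}^{d-1}$, so that $\tau = \sqrt{t^2 - |x|^2}$, and let $\Sigma_\tau$ be the hyperboloid on which $\sqrt{t^2-|x|^2}$ has the value $\tau$, with its induced Riemannian volume $\mathrm{dvol}_{\Sigma_\tau} = \tau^d \sinh(\rho)^{d-1}\, d\theta\, d\rho$, where $d\theta$ is the standard surface measure on the unit sphere $\mathbb{S}^{d-1}$ (counting measure if $d = 1$). Then there is a constant $C > 0$ depending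 only on $d$ and $\ell$ such that for every real-valued function $f$ of class $C^{\lfloor d/2 \rfloor + 1}$ on $\{t > |x|\}$ (in particular for every smooth $f$), and for all $\tau > 0$, $\rho \ge 0$, $\theta \in \mathbb{S}^{d-1}$, $$ |f(\tau, \rho, \theta)|^2 \le C\, \tau^{-d} \cosh(\rho)^{1-d-\ell} \sum_{|\alpha| \le \lfloor d/2 \rfloor + 1} \int_{\Sigma_\tau} \cosh(\rho)^{\ell}\, |L^\alpha f|^2 \; \mathrm{dvol}_{\Sigma_\tau}, $$ where the sum runs over all finite sequences $\alpha$ in $\{1, \dots, d\}$ of length at most $\lfloor d/2 \rfloor + 1$, and the right-hand side is allowed to be $+\infty$. -/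

import Mathlib

open MeasureTheory
open scoped ENNReal

noncomputable section

namespace LorentzBoost

/-- Minkowski space with one time and `d` space dimensions; a point is `(t, x)`, where `x` carries
the Euclidean norm. -/
abbrev Spacetime (d : ℕ) : Type := ℝ × EuclideanSpace ℝ (Fin d)

/-- The unit sphere of Euclidean `d`-space. -/
abbrev UnitSphere (d : ℕ) : Type := Metric.sphere (0 : EuclideanSpace ℝ (Fin d)) 1

/-- The interior of the forward light cone, `{t > |x|}`. -/
def forwardCone (d : ℕ) : Set (Spacetime d) := {p | ‖p.2‖ < p.1}

/-- The minimum integer `s` with `H^s ⊂ L^∞` in dimension `d`, that is `⌊d/2⌋ + 1`. -/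
def sobolevOrder (d : ℕ) : ℕ := d / 2 + 1

/-- The Lorentz boost `L^i = t ∂_{x^i} + x^i ∂_t`, acting on functions. -/
def boost {d : ℕ} (i : Fin d) (f : Spacetime d → ℝ) : Spacetime d → ℝ :=
  fun p => fderiv ℝ f p (p.2 i, p.1 • EuclideanSpace.single i (1 : ℝ))

/-- `L^α f = L^{α_m} L^{α_{m-1}} ⋯ L^{α_1} f` for an ordered tuple `α = (α_1, …, α_m)`
(here indexed from zero); the boost with the first index acts first. -/
def iterBoost {d : ℕ} : (m : ℕ) → (Fin m → Fin d) → (Spacetime d → ℝ) → Spacetime d → ℝ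
  | 0, _, f => f
  | m + 1, α, f => boost (α (Fin.last m)) (iterBoost m (fun j => α j.castSucc) f)

/-- The point with hyperboloidal polar coordinates `(τ, ρ, θ)`:
`t = τ cosh ρ`, `x = τ sinh ρ · θ`. -/
def hypPoint {d : ℕ} (τ ρ : ℝ) (θ : UnitSphere d) : Spacetime d :=
  (τ * Real.cosh ρ, (τ * Real.sinh ρ) • (θ : EuclideanSpace ℝ (Fin d)))

/-- The integral over the hyperboloid `Σ_τ = {t > 0, t² - |x|² = τ²}` of a nonnegative function `F`
of the polar coordinates `(ρ, θ)`, with respect to the induced Riemannian volume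
`dvol = τ^d sinh(ρ)^(d-1) dθ dρ`, where `dθ` is the standard surface measure of the unit sphere. -/
def hyperboloidIntegral {d : ℕ} (τ : ℝ) (F : ℝ → UnitSphere d → ℝ≥0∞) : ℝ≥0∞ :=
  ∫⁻ ρ in Set.Ioi (0 : ℝ), ∫⁻ θ : UnitSphere d,
    F ρ θ * ENNReal.ofReal (τ ^ d * Real.sinh ρ ^ (d - 1))
      ∂(volume : Measure (EuclideanSpace ℝ (Fin d))).toSphere

end LorentzBoost

end

/-! Fix a point of `Σ_τ` above `x`, with time coordinate `t`. For a unit vector `ω` the field `∑ ωⁱ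
Lⁱ` is tangent to `Σ_τ`, and its flow moves `x` along the ray `x + r ω`. The derivatives of `f`
along the flow are combinations of the `L^α f`, so `exists_sq_le_sum_integral` bounds `f²` at the
point by their squares integrated over flow time `s ∈ [0, 1]` with weight `s ^ (2⌊d/2⌋) ≤ s ^ (d -
1)`.

On this time interval the time coordinate stays within a factor `e` of `t` and `r ≥ t s / e`. Hence
`s ^ (d - 1) ds ≤ (e / t) ^ d r ^ (d - 1) dr` (`setLIntegral_flowRadius_le`), and powers of the time
coordinate change by bounded factors. Averaging over `ω` gives polar coordinates about `x`, that is,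
an integral over all of space. Since `dvol = (τ / t) dx` and `t = τ cosh ρ`, the factor `t ^ (-d) (t
/ τ) ^ (1 - ℓ)` is the stated decay. -/

namespace LorentzBoost

/-! ### Weighted one-dimensional Sobolev inequality -/

section OneDim

variable {h h' : ℝ → ℝ}

/-- A weighted Hardy inequality on the unit interval. -/
theorem integral_pow_mul_sq_le (a : ℕ) (hd : ∀ s ∈ Set.Icc (0 : ℝ) 1, HasDerivAt h (h' s) s)
    (hc : ContinuousOn h' (Set.Icc 0 1)) :
    ∫ s in (0 : ℝ)..1, s ^ a * h s ^ 2 ≤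
      2 * (((a : ℝ) + 2) ^ 2 + 4) * ∫ s in (0 : ℝ)..1, s ^ (a + 2) * (h s ^ 2 + h' s ^ 2) := by
  have huIcc : Set.uIcc (0 : ℝ) 1 = Set.Icc 0 1 := Set.uIcc_of_le zero_le_one
  have hh : ContinuousOn h (Set.Icc 0 1) := fun s hs => (hd s hs).continuousAt.continuousWithinAt
  have hint : ∀ {F : ℝ → ℝ}, ContinuousOn F (Set.Icc 0 1) →
      IntervalIntegrable F volume 0 1 := fun {F} hF =>
    ContinuousOn.intervalIntegrable (by rwa [huIcc])
  -- This primitive vanishes at both ends. Its derivative dominates `s ^ a h² / 2` minus the terms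
  -- of weight `s ^ (a + 2)`.
  have hderiv : ∀ s ∈ Set.uIcc (0 : ℝ) 1,
      HasDerivAt (fun s => s ^ (a + 1) * (1 - s) * h s ^ 2)
        (((a + 1 : ℝ) * s ^ a * (1 - s) - s ^ (a + 1)) * h s ^ 2
          + 2 * s ^ (a + 1) * (1 - s) * h s * h' s) s := by
    intro s hs
    rw [huIcc] at hs
    have h1 := ((hasDerivAt_pow (a + 1) s).mul ((hasDerivAt_id s).const_sub 1)).mul
      ((hd s hs).pow 2)
    refine h1.congr_deriv ?_
    simp
    ring
  have hzero := intervalIntegral.integral_eq_sub_of_hasDerivAt hderiv (hint (by fun_prop))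
  simp only [sub_self, mul_zero, zero_mul, ne_eq, Nat.add_eq_zero_iff, one_ne_zero, and_false,
    not_false_eq_true, zero_pow] at hzero
  have hmono : ∫ s in (0 : ℝ)..1, ((1 / 2 : ℝ) * (s ^ a * h s ^ 2)
        - (((a : ℝ) + 2) ^ 2 + 4) * (s ^ (a + 2) * (h s ^ 2 + h' s ^ 2))) ≤
      ∫ s in (0 : ℝ)..1, (((a + 1 : ℝ) * s ^ a * (1 - s) - s ^ (a + 1)) * h s ^ 2
          + 2 * s ^ (a + 1) * (1 - s) * h s * h' s) := by
    refine intervalIntegral.integral_mono_on zero_le_one (hint (by fun_prop)) (hint (by fun_prop))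
      fun s hs => ?_
    have hsa : 0 ≤ s ^ a := pow_nonneg hs.1 a
    have key : 0 ≤ (a + 1 - 1 / 2 : ℝ) * h s ^ 2 - (a + 2) * s * h s ^ 2
        + 2 * s * (1 - s) * h s * h' s + (((a : ℝ) + 2) ^ 2 + 4) * s ^ 2 * (h s ^ 2 + h' s ^ 2) := by
      have ha : (0 : ℝ) ≤ a := Nat.cast_nonneg a
      -- Each of the two squares absorbs one indefinite term and uses up `h² / 4`, within the
      -- available `(a + 1 / 2) h²`.
      have e1 := sq_nonneg ((1 / 2 - (a + 2) * s) * h s)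
      have e2 := sq_nonneg (1 / 2 * h s + 2 * s * (1 - s) * h' s)
      have e3 : (2 * s * (1 - s) * h' s) ^ 2 ≤ 4 * s ^ 2 * h' s ^ 2 := by
        have : (1 - s) ^ 2 ≤ 1 := by nlinarith [hs.1, hs.2]
        nlinarith [mul_nonneg (sq_nonneg (s * h' s)) (sub_nonneg.2 this)]
      have e4 : 0 ≤ (a : ℝ) * h s ^ 2 := by positivity
      have e5 : 0 ≤ ((a : ℝ) + 2) ^ 2 * s ^ 2 * h' s ^ 2 := by positivity
      have e6 : 0 ≤ 4 * s ^ 2 * h s ^ 2 := by positivity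
      nlinarith
    have := mul_nonneg hsa key
    ring_nf at this ⊢
    linarith
  rw [hzero, intervalIntegral.integral_sub (hint (by fun_prop)) (hint (by fun_prop)),
    intervalIntegral.integral_const_mul, intervalIntegral.integral_const_mul] at hmono
  linarith

/-- Integrate the derivative of `(1 - s) h²`, where the cutoff removes the boundary term at `1`. -/
theorem sq_le_integral (hd : ∀ s ∈ Set.Icc (0 : ℝ) 1, HasDerivAt h (h' s) s)
    (hc : ContinuousOn h' (Set.Icc 0 1)) :
    h 0 ^ 2 ≤ 2 * ∫ s in (0 : ℝ)..1, (h s ^ 2 + h' s ^ 2) := by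
  have huIcc : Set.uIcc (0 : ℝ) 1 = Set.Icc 0 1 := Set.uIcc_of_le zero_le_one
  have hh : ContinuousOn h (Set.Icc 0 1) := fun s hs => (hd s hs).continuousAt.continuousWithinAt
  have hint : ∀ {F : ℝ → ℝ}, ContinuousOn F (Set.Icc 0 1) →
      IntervalIntegrable F volume 0 1 := fun {F} hF =>
    ContinuousOn.intervalIntegrable (by rwa [huIcc])
  have hderiv : ∀ s ∈ Set.uIcc (0 : ℝ) 1,
      HasDerivAt (fun s => (1 - s) * h s ^ 2) (-h s ^ 2 + 2 * (1 - s) * h s * h' s) s := by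
    intro s hs
    rw [huIcc] at hs
    refine (((hasDerivAt_id s).const_sub 1).mul ((hd s hs).pow 2)).congr_deriv ?_
    simp
    ring
  have hzero := intervalIntegral.integral_eq_sub_of_hasDerivAt hderiv (hint (by fun_prop))
  have hmono : ∫ s in (0 : ℝ)..1, (-2 : ℝ) * (h s ^ 2 + h' s ^ 2) ≤
      ∫ s in (0 : ℝ)..1, (-h s ^ 2 + 2 * (1 - s) * h s * h' s) := by
    refine intervalIntegral.integral_mono_on zero_le_one (hint (by fun_prop)) (hint (by fun_prop))
      fun s hs => ?_
    have h1 : (1 - s) ^ 2 ≤ 1 := by nlinarith [hs.1, hs.2]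
    nlinarith [sq_nonneg (h s + (1 - s) * h' s),
      mul_nonneg (sq_nonneg (h' s)) (sub_nonneg.2 h1), sq_nonneg (h' s)]
  rw [hzero, intervalIntegral.integral_const_mul] at hmono
  simp only [sub_self, zero_mul, sub_zero, one_mul, zero_sub] at hmono
  linarith

/-- The value at `0` of a function with `m + 1` derivatives is controlled by `L²` norms on the unit
interval weighted by `s ^ (2 m)`. -/
theorem exists_sq_le_sum_integral (m : ℕ) : ∃ C : ℝ, 0 < C ∧ ∀ G : ℕ → ℝ → ℝ,
    (∀ k ≤ m, ∀ s ∈ Set.Icc (0 : ℝ) 1, HasDerivAt (G k) (G (k + 1) s) s) →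
    ContinuousOn (G (m + 1)) (Set.Icc 0 1) →
    G 0 0 ^ 2 ≤ C * ∑ k ∈ Finset.range (m + 2), ∫ s in (0 : ℝ)..1, s ^ (2 * m) * G k s ^ 2 := by
  have hint : ∀ {F : ℝ → ℝ}, ContinuousOn F (Set.Icc 0 1) →
      IntervalIntegrable F volume 0 1 := fun {F} hF =>
    ContinuousOn.intervalIntegrable (by rwa [Set.uIcc_of_le zero_le_one])
  have hnn : ∀ (F : ℝ → ℝ) (n : ℕ), 0 ≤ ∫ s in (0 : ℝ)..1, s ^ (2 * n) * F s ^ 2 := fun F n =>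
    intervalIntegral.integral_nonneg zero_le_one fun s _ =>
      mul_nonneg (by rw [pow_mul]; positivity) (sq_nonneg _)
  induction m with
  | zero =>
    refine ⟨2, two_pos, fun G hG hc => ?_⟩
    have h0 := hG 0 le_rfl
    have hc0 : ContinuousOn (G 0) (Set.Icc 0 1) :=
      fun s hs => (h0 s hs).continuousAt.continuousWithinAt
    simp only [zero_add] at h0 hc
    refine (sq_le_integral h0 hc).trans_eq ?_
    rw [intervalIntegral.integral_add (hint (by fun_prop)) (hint (by fun_prop))]
    simp [Finset.sum_range_succ]
  | succ m ih =>
    obtain ⟨C, hC, ih⟩ := ih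
    set K : ℝ := 2 * (((2 * m : ℕ) + 2 : ℝ) ^ 2 + 4) with hK
    have hKpos : 0 < K := by positivity
    refine ⟨C * (K * 2), by positivity, fun G hG hc => ?_⟩
    have hcont : ∀ k ≤ m + 2, ContinuousOn (G k) (Set.Icc 0 1) := by
      intro k hk
      rcases hk.lt_or_eq with hk | rfl
      · exact fun s hs => (hG k (by omega) s hs).continuousAt.continuousWithinAt
      · exact hc
    have hstep := ih G (fun k hk => hG k (by omega)) (hcont _ (by omega))
    refine hstep.trans ?_
    rw [mul_assoc C]
    refine mul_le_mul_of_nonneg_left ?_ hC.le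
    rw [mul_assoc]
    set I : ℕ → ℝ := fun k => ∫ s in (0 : ℝ)..1, s ^ (2 * (m + 1)) * G k s ^ 2 with hI
    -- The Hardy inequality trades two powers of `s` for one more derivative.
    have hb : ∀ k ∈ Finset.range (m + 2), ∫ s in (0 : ℝ)..1, s ^ (2 * m) * G k s ^ 2 ≤
        K * (I k + I (k + 1)) := by
      intro k hk
      have hk := Finset.mem_range.1 hk
      have := integral_pow_mul_sq_le (2 * m) (hG k (by omega)) (hcont (k + 1) (by omega))
      refine this.trans_eq ?_
      have c1 := hcont k (by omega)
      have c2 := hcont (k + 1) (by omega)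
      rw [hI, ← intervalIntegral.integral_add (hint (by fun_prop)) (hint (by fun_prop))]
      congr 2
      ext s
      ring
    refine (Finset.sum_le_sum hb).trans ?_
    rw [← Finset.mul_sum, Finset.sum_add_distrib]
    refine mul_le_mul_of_nonneg_left ?_ hKpos.le
    have h1 : ∑ k ∈ Finset.range (m + 2), I k ≤ ∑ k ∈ Finset.range (m + 3), I k := by
      rw [Finset.sum_range_succ I (m + 2)]
      linarith [hnn (G (m + 2)) (m + 1)]
    have h2 : ∑ k ∈ Finset.range (m + 2), I (k + 1) ≤ ∑ k ∈ Finset.range (m + 3), I k := by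
      rw [Finset.sum_range_succ' I (m + 2)]
      linarith [hnn (G 0) (m + 1)]
    change _ ≤ 2 * ∑ k ∈ Finset.range (m + 3), I k
    linarith

end OneDim

end LorentzBoost

namespace LorentzBoost

/-! ### Polar coordinates and the hyperboloid as a graph -/

section Polar

variable {d : ℕ}

theorem lintegral_eq_lintegral_sphere_prod (hd : 1 ≤ d) (F : EuclideanSpace ℝ (Fin d) → ℝ≥0∞) :
    ∫⁻ x, F x = ∫⁻ q : UnitSphere d × Set.Ioi (0 : ℝ),
      F (q.2.1 • (q.1 : EuclideanSpace ℝ (Fin d)))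
      ∂((volume : Measure (EuclideanSpace ℝ (Fin d))).toSphere.prod
        (Measure.volumeIoiPow (d - 1))) := by
  have : Nonempty (Fin d) := ⟨⟨0, hd⟩⟩
  have hmp := (volume : Measure (EuclideanSpace ℝ (Fin d))).measurePreserving_homeomorphUnitSphereProd
  rw [finrank_euclideanSpace_fin] at hmp
  have hsymm := hmp.symm (homeomorphUnitSphereProd (EuclideanSpace ℝ (Fin d))).toMeasurableEquiv
  have := hsymm.lintegral_comp_emb
    (homeomorphUnitSphereProd (EuclideanSpace ℝ (Fin d))).toMeasurableEquiv.symm.measurableEmbedding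
    (fun x => F x)
  refine Eq.trans ?_ this.symm
  rw [lintegral_subtype_comap (measurableSet_singleton _).compl, restrict_compl_singleton]

theorem lintegral_volumeIoiPow (n : ℕ) (G : ℝ → ℝ≥0∞) :
    ∫⁻ r, G r.1 ∂(Measure.volumeIoiPow n) =
      ∫⁻ r in Set.Ioi (0 : ℝ), ENNReal.ofReal (r ^ n) * G r := by
  rw [Measure.volumeIoiPow, lintegral_withDensity_eq_lintegral_mul_non_measurable₀ _
    (by fun_prop) (by simp)]
  exact lintegral_subtype_comap measurableSet_Ioi fun r : ℝ => ENNReal.ofReal (r ^ n) * G r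

/-- Integration in polar coordinates, the radius being integrated first. -/
theorem lintegral_eq_lintegral_sphere_lintegral_Ioi (hd : 1 ≤ d)
    {F : EuclideanSpace ℝ (Fin d) → ℝ≥0∞} (hF : Measurable F) :
    ∫⁻ x, F x = ∫⁻ θ : UnitSphere d, (∫⁻ r in Set.Ioi (0 : ℝ),
      ENNReal.ofReal (r ^ (d - 1)) * F (r • (θ : EuclideanSpace ℝ (Fin d))))
      ∂(volume : Measure (EuclideanSpace ℝ (Fin d))).toSphere := by
  rw [lintegral_eq_lintegral_sphere_prod hd, lintegral_prod _ (by fun_prop)]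
  refine lintegral_congr fun θ => ?_
  exact lintegral_volumeIoiPow (d - 1) fun r => F (r • (θ : EuclideanSpace ℝ (Fin d)))

/-- Integration in polar coordinates, the angle being integrated first. -/
theorem lintegral_eq_lintegral_Ioi_lintegral_sphere (hd : 1 ≤ d)
    {F : EuclideanSpace ℝ (Fin d) → ℝ≥0∞} (hF : Measurable F) :
    ∫⁻ x, F x = ∫⁻ r in Set.Ioi (0 : ℝ), ENNReal.ofReal (r ^ (d - 1)) *
      ∫⁻ θ : UnitSphere d, F (r • (θ : EuclideanSpace ℝ (Fin d)))
        ∂(volume : Measure (EuclideanSpace ℝ (Fin d))).toSphere := by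
  rw [lintegral_eq_lintegral_sphere_prod hd, lintegral_prod_symm _ (by fun_prop)]
  exact lintegral_volumeIoiPow (d - 1) fun r => ∫⁻ θ : UnitSphere d,
    F (r • (θ : EuclideanSpace ℝ (Fin d))) ∂(volume : Measure _).toSphere

theorem image_mul_sinh_Ioi {τ : ℝ} (hτ : 0 < τ) :
    (fun ρ => τ * Real.sinh ρ) '' Set.Ioi 0 = Set.Ioi 0 := by
  ext r
  constructor
  · rintro ⟨ρ, hρ, rfl⟩
    exact mul_pos hτ (Real.sinh_pos_iff.2 hρ)
  · intro hr
    refine ⟨Real.arsinh (r / τ), Real.arsinh_pos_iff.2 (div_pos hr hτ), ?_⟩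
    simp only [Real.sinh_arsinh]
    field_simp

/-- The point of the hyperboloid `Σ_τ` above `x`. -/
noncomputable def lift (τ : ℝ) (x : EuclideanSpace ℝ (Fin d)) : Spacetime d :=
  (√(τ ^ 2 + ‖x‖ ^ 2), x)

theorem lift_mem_forwardCone {τ : ℝ} (hτ : 0 < τ) (x : EuclideanSpace ℝ (Fin d)) :
    lift τ x ∈ forwardCone d := by
  change ‖x‖ < √(τ ^ 2 + ‖x‖ ^ 2)
  exact Real.lt_sqrt_of_sq_lt (by nlinarith)

theorem continuous_lift (τ : ℝ) : Continuous (lift τ : EuclideanSpace ℝ (Fin d) → Spacetime d) := by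
  unfold lift
  fun_prop

theorem lift_sinh_smul {τ ρ : ℝ} (hτ : 0 < τ) (θ : UnitSphere d) :
    lift τ ((τ * Real.sinh ρ) • (θ : EuclideanSpace ℝ (Fin d))) = hypPoint τ ρ θ := by
  have hθ : ‖(θ : EuclideanSpace ℝ (Fin d))‖ = 1 := by simp
  refine Prod.ext ?_ rfl
  change √(τ ^ 2 + ‖_‖ ^ 2) = τ * Real.cosh ρ
  rw [norm_smul, hθ, mul_one, Real.norm_eq_abs, sq_abs,
    show τ ^ 2 + (τ * Real.sinh ρ) ^ 2 = (τ * Real.cosh ρ) ^ 2 by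
      rw [mul_pow, mul_pow, Real.cosh_sq]; ring]
  exact Real.sqrt_sq (mul_nonneg hτ.le (Real.cosh_pos ρ).le)

theorem measurable_weight_mul_sq {τ : ℝ} (hτ : 0 < τ) (p : ℝ) {g : Spacetime d → ℝ}
    (hg : ContinuousOn g (forwardCone d)) :
    Measurable fun x => ((lift τ x).1 / τ) ^ p * |g (lift τ x)| ^ 2 :=
  (((continuous_lift τ).fst.measurable.div_const τ).pow_const p).mul
    ((hg.comp_continuous (continuous_lift τ) (lift_mem_forwardCone hτ)).abs.measurable.pow_const 2)

/-- The integral over the hyperboloid in the coordinates `x`, where the volume is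
`(τ / t) dx`. -/
theorem hyperboloidIntegral_eq_lintegral (hd : 1 ≤ d) {τ : ℝ} (hτ : 0 < τ) (ℓ : ℝ)
    {g : Spacetime d → ℝ} (hg : ContinuousOn g (forwardCone d)) :
    hyperboloidIntegral τ (fun ρ (θ : UnitSphere d) =>
        ENNReal.ofReal (Real.cosh ρ ^ ℓ * |g (hypPoint τ ρ θ)| ^ 2)) =
      ∫⁻ x, ENNReal.ofReal (((lift τ x).1 / τ) ^ (ℓ - 1) * |g (lift τ x)| ^ 2) := by
  -- Substitute `r = τ sinh ρ`. The factor `cosh ρ` in `dr = τ cosh ρ dρ` raises the exponent `ℓ -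
  -- 1` to `ℓ`.
  rw [lintegral_eq_lintegral_Ioi_lintegral_sphere hd
      (measurable_weight_mul_sq hτ (ℓ - 1) hg).ennreal_ofReal, ← image_mul_sinh_Ioi hτ,
    lintegral_image_eq_lintegral_abs_deriv_mul measurableSet_Ioi
      (fun ρ _ => ((Real.hasDerivAt_sinh ρ).const_mul τ).hasDerivWithinAt)
      (fun x _ y _ h => Real.sinh_injective (mul_left_cancel₀ hτ.ne' h))]
  refine setLIntegral_congr_fun measurableSet_Ioi fun ρ hρ => ?_
  have hch := Real.cosh_pos ρ
  have hsh : 0 < τ * Real.sinh ρ := mul_pos hτ (Real.sinh_pos_iff.2 hρ)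
  simp only [lift_sinh_smul hτ]
  rw [← lintegral_const_mul' _ _ ENNReal.ofReal_ne_top,
    ← lintegral_const_mul' _ _ ENNReal.ofReal_ne_top]
  refine lintegral_congr fun θ => ?_
  rw [← ENNReal.ofReal_mul (by positivity), ← ENNReal.ofReal_mul (pow_nonneg hsh.le _),
    ← ENNReal.ofReal_mul (abs_nonneg _)]
  congr 1
  have h1 : (hypPoint τ ρ θ).1 / τ = Real.cosh ρ := by
    simp only [hypPoint]
    field_simp
  rw [h1, Real.rpow_sub_one hch.ne', abs_of_pos (mul_pos hτ hch)]
  obtain ⟨n, rfl⟩ := Nat.exists_eq_add_of_le' hd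
  simp only [Nat.add_sub_cancel]
  field_simp
  ring

end Polar

end LorentzBoost

namespace LorentzBoost

/-! ### Flow of a constant combination of boosts -/

section Flow

variable {d : ℕ}

theorem isOpen_forwardCone (d : ℕ) : IsOpen (forwardCone d) :=
  isOpen_lt (by fun_prop) (by fun_prop)

theorem contDiffOn_boost {n : ℕ} {g : Spacetime d → ℝ} (i : Fin d)
    (hg : ContDiffOn ℝ (n + 1 : ℕ) g (forwardCone d)) :
    ContDiffOn ℝ n (boost i g) (forwardCone d) := by
  have h1 : ContDiffOn ℝ n (fderiv ℝ g) (forwardCone d) :=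
    hg.fderiv_of_isOpen (isOpen_forwardCone d) (by norm_cast)
  refine h1.clm_apply (ContDiff.contDiffOn ?_)
  fun_prop

theorem contDiffOn_iterBoost {N : ℕ} {f : Spacetime d → ℝ}
    (hf : ContDiffOn ℝ N f (forwardCone d)) :
    ∀ (m n : ℕ) (α : Fin m → Fin d), m + n = N →
      ContDiffOn ℝ n (iterBoost m α f) (forwardCone d)
  | 0, n, _, h => by
    obtain rfl : n = N := by omega
    exact hf
  | m + 1, n, α, h =>
    contDiffOn_boost _ (contDiffOn_iterBoost hf m (n + 1) (fun j => α j.castSucc) (by omega))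

theorem continuousOn_iterBoost {N m : ℕ} {f : Spacetime d → ℝ}
    (hf : ContDiffOn ℝ N f (forwardCone d)) (hm : m ≤ N) (α : Fin m → Fin d) :
    ContinuousOn (iterBoost m α f) (forwardCone d) :=
  (contDiffOn_iterBoost hf m (N - m) α (by omega)).continuousOn

/-- The distance in direction `ω` travelled after the time `s` by the flow of `∑ ωⁱ Lⁱ`, started at
a point with time coordinate `t` and with `⟪x, ω⟫ = b`. -/
noncomputable def flowRadius (t b s : ℝ) : ℝ := (Real.cosh s - 1) * b + Real.sinh s * t

/-- The time coordinate after the time `s` of the flow of `∑ ωⁱ Lⁱ`. -/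
noncomputable def flowTime (t b s : ℝ) : ℝ := Real.sinh s * b + Real.cosh s * t

theorem hasDerivAt_flowRadius (t b s : ℝ) :
    HasDerivAt (flowRadius t b) (flowTime t b s) s :=
  (((Real.hasDerivAt_cosh s).sub_const 1).mul_const b).add ((Real.hasDerivAt_sinh s).mul_const t)

theorem hasDerivAt_flowTime (t b s : ℝ) :
    HasDerivAt (flowTime t b) (b + flowRadius t b s) s := by
  refine (((Real.hasDerivAt_sinh s).mul_const b).add
    ((Real.hasDerivAt_cosh s).mul_const t)).congr_deriv ?_
  unfold flowRadius
  ring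

/-- The flow time equals `e^{-s} t + sinh s (b + t)`, with a nonnegative second term. -/
theorem le_flowTime {t b s : ℝ} (hb : |b| ≤ t) (hs : s ∈ Set.Icc (0 : ℝ) 1) :
    Real.exp (-1) * t ≤ flowTime t b s := by
  have h0 : 0 ≤ Real.sinh s := Real.sinh_nonneg_iff.2 hs.1
  have h1 : Real.exp (-1) ≤ Real.cosh s - Real.sinh s := by
    rw [Real.cosh_sub_sinh]
    exact Real.exp_le_exp.2 (by linarith [hs.2])
  have ht : 0 ≤ t := (abs_nonneg b).trans hb
  unfold flowTime
  nlinarith [mul_nonneg h0 (by linarith [neg_abs_le b] : 0 ≤ b + t), mul_le_mul_of_nonneg_right h1 ht]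

theorem flowTime_le {t b s : ℝ} (hb : |b| ≤ t) (hs : s ∈ Set.Icc (0 : ℝ) 1) :
    flowTime t b s ≤ Real.exp 1 * t := by
  have h0 : 0 ≤ Real.sinh s := Real.sinh_nonneg_iff.2 hs.1
  have h1 : Real.cosh s + Real.sinh s ≤ Real.exp 1 := by
    rw [Real.cosh_add_sinh]
    exact Real.exp_le_exp.2 hs.2
  have ht : 0 ≤ t := (abs_nonneg b).trans hb
  unfold flowTime
  nlinarith [mul_nonneg h0 (by linarith [le_abs_self b] : 0 ≤ t - b),
    mul_le_mul_of_nonneg_right h1 ht]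

/-- The radius equals `(cosh s - 1)(b + t) + (1 - e^{-s}) t`, and `1 - e^{-s} ≥ s e^{-s} ≥ s / e`.
Growth thus stays linear even when `b = -t`. -/
theorem le_flowRadius {t b s : ℝ} (hb : |b| ≤ t) (hs : s ∈ Set.Icc (0 : ℝ) 1) :
    Real.exp (-1) * t * s ≤ flowRadius t b s := by
  have h0 : 0 ≤ Real.cosh s - 1 := by linarith [Real.one_le_cosh s]
  have ht : 0 ≤ t := (abs_nonneg b).trans hb
  have h1 : Real.exp (-1) * s ≤ Real.sinh s - Real.cosh s + 1 := by
    have e1 : Real.exp (-1) ≤ Real.exp (-s) := Real.exp_le_exp.2 (by linarith [hs.2])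
    have e2 := Real.cosh_sub_sinh s
    have e3 : Real.exp (-s) * Real.exp s = 1 := by rw [← Real.exp_add]; simp
    nlinarith [Real.add_one_le_exp s, Real.exp_pos (-s), mul_le_mul_of_nonneg_right e1 hs.1]
  unfold flowRadius
  nlinarith [mul_nonneg h0 (by linarith [neg_abs_le b] : 0 ≤ b + t), mul_le_mul_of_nonneg_right h1 ht]

/-- Along a ray, the flow time may be replaced by the distance as variable of integration. -/
theorem setLIntegral_flowRadius_le (n : ℕ) {t b : ℝ} (ht : 0 < t) (hb : |b| ≤ t) (G : ℝ → ℝ≥0∞) :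
    ∫⁻ s in Set.Ioc (0 : ℝ) 1, ENNReal.ofReal (s ^ n) * G (flowRadius t b s) ≤
      ENNReal.ofReal ((Real.exp 1 / t) ^ (n + 1)) *
        ∫⁻ r in Set.Ioi (0 : ℝ), ENNReal.ofReal (r ^ n) * G r := by
  have he : 0 < Real.exp (-1) * t := by positivity
  have hsub : Set.Ioc (0 : ℝ) 1 ⊆ Set.Icc 0 1 := Set.Ioc_subset_Icc_self
  have hinj : Set.InjOn (flowRadius t b) (Set.Ioc 0 1) := by
    refine StrictMonoOn.injOn ?_
    refine (strictMonoOn_of_deriv_pos (convex_Icc 0 1)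
      (fun s _ => (hasDerivAt_flowRadius t b s).continuousAt.continuousWithinAt) ?_).mono hsub
    intro s hs
    rw [(hasDerivAt_flowRadius t b s).deriv]
    exact he.trans_le (le_flowTime hb (interior_subset hs))
  have himg : flowRadius t b '' Set.Ioc 0 1 ⊆ Set.Ioi 0 := by
    rintro _ ⟨s, hs, rfl⟩
    exact (mul_pos he hs.1).trans_le (le_flowRadius hb (hsub hs))
  -- One factor `e / t` pays for the Jacobian `flowTime`, the other `n` for replacing `s ^ n` by the
  -- radius to the power `n`.
  calc _ ≤ ∫⁻ s in Set.Ioc (0 : ℝ) 1, ENNReal.ofReal ((Real.exp 1 / t) ^ (n + 1)) *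
        (ENNReal.ofReal |flowTime t b s| *
          (ENNReal.ofReal (flowRadius t b s ^ n) * G (flowRadius t b s))) := by
        refine setLIntegral_mono' measurableSet_Ioc fun s hs => ?_
        rw [← mul_assoc, ← mul_assoc]
        refine mul_le_mul_left ?_ _
        rw [← ENNReal.ofReal_mul (by positivity), ← ENNReal.ofReal_mul (by positivity)]
        refine ENNReal.ofReal_le_ofReal ?_
        have h1 := le_flowTime hb (hsub hs)
        have h2 := le_flowRadius hb (hsub hs)
        have h3 : Real.exp 1 * Real.exp (-1) = 1 := by rw [← Real.exp_add]; simp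
        calc s ^ n = (Real.exp 1 / t) ^ (n + 1) * (Real.exp (-1) * t) *
              (Real.exp (-1) * t * s) ^ n := by
              have : Real.exp 1 / t * (Real.exp (-1) * t) = 1 := by
                field_simp
                exact h3
              calc s ^ n = (Real.exp 1 / t * (Real.exp (-1) * t)) ^ (n + 1) * s ^ n := by
                    rw [this]; simp
                _ = _ := by ring
          _ ≤ _ := by
              have hs0 := hs.1.le
              gcongr
              exact h1.trans (le_abs_self _)
    _ = ENNReal.ofReal ((Real.exp 1 / t) ^ (n + 1)) *
        ∫⁻ r in flowRadius t b '' Set.Ioc 0 1, ENNReal.ofReal (r ^ n) * G r := by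
        rw [lintegral_const_mul' _ _ ENNReal.ofReal_ne_top,
          lintegral_image_eq_lintegral_abs_deriv_mul measurableSet_Ioc
            (fun s _ => (hasDerivAt_flowRadius t b s).hasDerivWithinAt) hinj]
    _ ≤ _ := by
        gcongr

/-- The flow of `∑ ωⁱ Lⁱ` started at `lift τ x`. -/
noncomputable def flow (τ : ℝ) (x ω : EuclideanSpace ℝ (Fin d)) (s : ℝ) : Spacetime d :=
  (flowTime (lift τ x).1 (inner ℝ x ω) s, x + flowRadius (lift τ x).1 (inner ℝ x ω) s • ω)

theorem abs_inner_le_lift {τ : ℝ} (hτ : 0 < τ) {x ω : EuclideanSpace ℝ (Fin d)} (hω : ‖ω‖ = 1) :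
    |inner ℝ x ω| ≤ (lift τ x).1 := by
  refine (abs_real_inner_le_norm x ω).trans ?_
  rw [hω, mul_one]
  exact (lift_mem_forwardCone hτ x).le

theorem lift_fst_pos {τ : ℝ} (hτ : 0 < τ) (x : EuclideanSpace ℝ (Fin d)) : 0 < (lift τ x).1 :=
  (norm_nonneg x).trans_lt (lift_mem_forwardCone hτ x)

/-- Boosts preserve `t² - |x|²`; positivity of the flow time selects the upper sheet. -/
theorem flow_eq_lift {τ : ℝ} (hτ : 0 < τ) {x ω : EuclideanSpace ℝ (Fin d)} (hω : ‖ω‖ = 1) {s : ℝ}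
    (hs : s ∈ Set.Icc (0 : ℝ) 1) :
    flow τ x ω s =
      lift τ (x + flowRadius (lift τ x).1 (inner ℝ x ω) s • ω) := by
  refine Prod.ext ?_ rfl
  have hb := abs_inner_le_lift (x := x) hτ hω
  have ht := lift_fst_pos hτ x
  have hpos : 0 ≤ flowTime (lift τ x).1 (inner ℝ x ω) s :=
    (mul_pos (Real.exp_pos _) ht).le.trans (le_flowTime hb hs)
  have hsq : (lift τ x).1 ^ 2 = τ ^ 2 + ‖x‖ ^ 2 := Real.sq_sqrt (by positivity)
  change flowTime (lift τ x).1 (inner ℝ x ω) s = √(τ ^ 2 + ‖_‖ ^ 2)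
  rw [eq_comm, Real.sqrt_eq_iff_eq_sq (by positivity) hpos, norm_add_sq_real, inner_smul_right,
    norm_smul, hω, mul_one, Real.norm_eq_abs, sq_abs]
  have hc := Real.cosh_sq s
  unfold flowTime flowRadius
  generalize inner ℝ x ω = b
  generalize (lift τ x).1 = t at hsq
  linear_combination -hsq + (b ^ 2 - t ^ 2) * hc

theorem flow_mem_forwardCone {τ : ℝ} (hτ : 0 < τ) {x ω : EuclideanSpace ℝ (Fin d)} (hω : ‖ω‖ = 1)
    {s : ℝ} (hs : s ∈ Set.Icc (0 : ℝ) 1) : flow τ x ω s ∈ forwardCone d := by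
  rw [flow_eq_lift hτ hω hs]
  exact lift_mem_forwardCone hτ _

theorem hasDerivAt_flow (τ : ℝ) (x : EuclideanSpace ℝ (Fin d)) {ω : EuclideanSpace ℝ (Fin d)}
    (hω : ‖ω‖ = 1) (s : ℝ) :
    HasDerivAt (flow τ x ω)
      (∑ i, ω i • ((flow τ x ω s).2 i,
        (flow τ x ω s).1 • EuclideanSpace.single i (1 : ℝ))) s := by
  have h := (hasDerivAt_flowTime (lift τ x).1 (inner ℝ x ω) s).prodMk
    (((hasDerivAt_flowRadius (lift τ x).1 (inner ℝ x ω) s).smul_const ω).const_add x)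
  refine h.congr_deriv ?_
  refine Prod.ext ?_ ?_
  · have : (∑ i, ω i * (flow τ x ω s).2 i) = inner ℝ (flow τ x ω s).2 ω := by
      simp [PiLp.inner_apply]
    simp only [Prod.fst_sum, Prod.smul_fst, smul_eq_mul]
    rw [this]
    simp only [flow, inner_add_left, inner_smul_left, real_inner_self_eq_norm_sq, hω]
    simp
  · simp only [Prod.snd_sum, Prod.smul_snd, flow]
    ext j
    simp [Pi.single_apply, mul_comm]

theorem hasDerivAt_comp_flow {τ : ℝ} (hτ : 0 < τ) {x ω : EuclideanSpace ℝ (Fin d)} (hω : ‖ω‖ = 1)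
    {g : Spacetime d → ℝ} (hg : DifferentiableOn ℝ g (forwardCone d)) {s : ℝ}
    (hs : s ∈ Set.Icc (0 : ℝ) 1) :
    HasDerivAt (fun s => g (flow τ x ω s)) (∑ i, ω i * boost i g (flow τ x ω s)) s := by
  have hmem := flow_mem_forwardCone (x := x) hτ hω hs
  have hd := (hg.differentiableAt ((isOpen_forwardCone d).mem_nhds hmem)).hasFDerivAt
  refine (hd.comp_hasDerivAt s (hasDerivAt_flow τ x hω s)).congr_deriv ?_
  rw [map_sum]
  refine Finset.sum_congr rfl fun i _ => ?_
  rw [map_smul, smul_eq_mul, boost]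

/-- The `k`-th derivative of `f` along the flow of `∑ ωⁱ Lⁱ`. -/
noncomputable def flowDeriv (τ : ℝ) (x ω : EuclideanSpace ℝ (Fin d)) (f : Spacetime d → ℝ)
    (k : ℕ) (s : ℝ) : ℝ :=
  ∑ α : Fin k → Fin d, (∏ j, ω (α j)) * iterBoost k α f (flow τ x ω s)

/-- The coefficients `ωⁱ` are constant, so each differentiation only applies one more boost from the
outside. Boosts do not commute, hence the sum over ordered tuples. -/
theorem hasDerivAt_flowDeriv {τ : ℝ} (hτ : 0 < τ) {x ω : EuclideanSpace ℝ (Fin d)} (hω : ‖ω‖ = 1)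
    {N k : ℕ} {f : Spacetime d → ℝ} (hf : ContDiffOn ℝ N f (forwardCone d)) (hk : k < N) {s : ℝ}
    (hs : s ∈ Set.Icc (0 : ℝ) 1) :
    HasDerivAt (flowDeriv τ x ω f k) (flowDeriv τ x ω f (k + 1) s) s := by
  have h : HasDerivAt (flowDeriv τ x ω f k) (∑ α : Fin k → Fin d, (∏ j, ω (α j)) *
      ∑ i, ω i * boost i (iterBoost k α f) (flow τ x ω s)) s := by
    refine HasDerivAt.fun_sum fun α _ => HasDerivAt.const_mul _ ?_
    refine hasDerivAt_comp_flow hτ hω ?_ hs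
    refine (contDiffOn_iterBoost hf k (N - k) α (by omega)).differentiableOn ?_
    norm_cast
    omega
  refine h.congr_deriv ?_
  unfold flowDeriv
  -- The outermost boost carries the last index of the tuple.
  rw [← (Fin.snocEquiv fun _ : Fin (k + 1) => Fin d).sum_comp, Fintype.sum_prod_type,
    Finset.sum_comm]
  refine Finset.sum_congr rfl fun α _ => ?_
  rw [Finset.mul_sum]
  refine Finset.sum_congr rfl fun i _ => ?_
  simp [Fin.prod_univ_castSucc, iterBoost, Fin.snocEquiv, mul_assoc]

theorem continuousOn_flowDeriv {τ : ℝ} (hτ : 0 < τ) {x ω : EuclideanSpace ℝ (Fin d)} (hω : ‖ω‖ = 1)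
    {N k : ℕ} {f : Spacetime d → ℝ} (hf : ContDiffOn ℝ N f (forwardCone d)) (hk : k ≤ N) :
    ContinuousOn (flowDeriv τ x ω f k) (Set.Icc 0 1) := by
  refine continuousOn_finsetSum _ fun α _ => ContinuousOn.mul continuousOn_const ?_
  exact (continuousOn_iterBoost hf hk α).comp
    (fun s _ => (hasDerivAt_flow τ x hω s).continuousAt.continuousWithinAt)
    fun s hs => flow_mem_forwardCone hτ hω hs

/-- Cauchy–Schwarz over the `d ^ k` tuples, with `|ωⁱ| ≤ 1`. -/
theorem flowDeriv_sq_le (τ : ℝ) (x : EuclideanSpace ℝ (Fin d)) {ω : EuclideanSpace ℝ (Fin d)}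
    (hω : ‖ω‖ = 1) (f : Spacetime d → ℝ) (k : ℕ) (s : ℝ) :
    flowDeriv τ x ω f k s ^ 2 ≤
      (d : ℝ) ^ k * ∑ α : Fin k → Fin d, |iterBoost k α f (flow τ x ω s)| ^ 2 := by
  refine sq_sum_le_card_mul_sum_sq.trans ?_
  simp only [Finset.card_univ, Fintype.card_fun, Fintype.card_fin, Nat.cast_pow]
  refine mul_le_mul_of_nonneg_left (Finset.sum_le_sum fun α _ => ?_) (by positivity)
  rw [mul_pow, sq_abs]
  refine mul_le_of_le_one_left (sq_nonneg _) ?_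
  rw [sq_le_one_iff_abs_le_one, Finset.abs_prod]
  refine Finset.prod_le_one (fun _ _ => abs_nonneg _) fun j _ => ?_
  exact (PiLp.norm_apply_le ω (α j)).trans_eq hω

end Flow

end LorentzBoost

namespace LorentzBoost

/-! ### Sobolev inequality along rays and on the hyperboloid -/

section Sobolev

variable {d : ℕ}

/-- The weighted sum of the squares of the boost derivatives of order at most `N`, as a function
on the hyperboloid `Σ_τ` in the coordinates `x`. -/
noncomputable def energyDensity (τ ℓ : ℝ) (N : ℕ) (f : Spacetime d → ℝ)
    (x : EuclideanSpace ℝ (Fin d)) : ℝ :=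
  ((lift τ x).1 / τ) ^ (ℓ - 1) *
    ∑ k ∈ Finset.range (N + 1), ∑ α : Fin k → Fin d, |iterBoost k α f (lift τ x)| ^ 2

theorem energyDensity_eq (τ ℓ : ℝ) (N : ℕ) (f : Spacetime d → ℝ) (x : EuclideanSpace ℝ (Fin d)) :
    energyDensity τ ℓ N f x = ∑ k ∈ Finset.range (N + 1), ∑ α : Fin k → Fin d,
      ((lift τ x).1 / τ) ^ (ℓ - 1) * |iterBoost k α f (lift τ x)| ^ 2 := by
  simp only [energyDensity, Finset.mul_sum]

theorem measurable_energyDensity {τ : ℝ} (hτ : 0 < τ) (ℓ : ℝ) {N : ℕ} {f : Spacetime d → ℝ}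
    (hf : ContDiffOn ℝ N f (forwardCone d)) : Measurable (energyDensity τ ℓ N f) := by
  rw [show energyDensity τ ℓ N f = _ from funext (energyDensity_eq τ ℓ N f)]
  refine Finset.measurable_fun_sum _ fun k hk => Finset.measurable_fun_sum _ fun α _ => ?_
  exact measurable_weight_mul_sq hτ _
    (continuousOn_iterBoost hf (by have := Finset.mem_range.1 hk; omega) α)

theorem lintegral_energyDensity (hd : 1 ≤ d) {τ : ℝ} (hτ : 0 < τ) (ℓ : ℝ) {N : ℕ}
    {f : Spacetime d → ℝ} (hf : ContDiffOn ℝ N f (forwardCone d)) :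
    ∫⁻ x, ENNReal.ofReal (energyDensity τ ℓ N f x) =
      ∑ k ∈ Finset.range (N + 1), ∑ α : Fin k → Fin d,
        hyperboloidIntegral τ (fun ρ (θ : UnitSphere d) =>
          ENNReal.ofReal (Real.cosh ρ ^ ℓ * |iterBoost k α f (hypPoint τ ρ θ)| ^ 2)) := by
  have hc : ∀ k ∈ Finset.range (N + 1), ∀ α : Fin k → Fin d,
      ContinuousOn (iterBoost k α f) (forwardCone d) := fun k hk α =>
    continuousOn_iterBoost hf (by have := Finset.mem_range.1 hk; omega) α
  have hnn : ∀ (x : EuclideanSpace ℝ (Fin d)) (k : ℕ) (α : Fin k → Fin d),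
      0 ≤ ((lift τ x).1 / τ) ^ (ℓ - 1) * |iterBoost k α f (lift τ x)| ^ 2 := fun x k α =>
    mul_nonneg (Real.rpow_nonneg (div_pos (lift_fst_pos hτ x) hτ).le _) (by positivity)
  simp only [energyDensity_eq]
  simp_rw [ENNReal.ofReal_sum_of_nonneg fun k _ => Finset.sum_nonneg fun α _ => hnn _ k α,
    ENNReal.ofReal_sum_of_nonneg fun α _ => hnn _ _ α]
  rw [lintegral_finsetSum' _ fun k hk => (Finset.measurable_fun_sum _ fun α _ =>
    (measurable_weight_mul_sq hτ _ (hc k hk α)).ennreal_ofReal).aemeasurable]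
  refine Finset.sum_congr rfl fun k hk => ?_
  rw [lintegral_finsetSum' _ fun α _ =>
    (measurable_weight_mul_sq hτ _ (hc k hk α)).ennreal_ofReal.aemeasurable]
  exact Finset.sum_congr rfl fun α _ => (hyperboloidIntegral_eq_lintegral hd hτ ℓ (hc k hk α)).symm

/-- Since `|log (T / t)| ≤ 1`, the power `(T / t) ^ p` is at least `e ^ (-|p|)` for either sign of
`p`. This carries the weight from the flow's endpoint back to its start. -/
theorem one_le_exp_mul_rpow {t T τ : ℝ} (hτ : 0 < τ) (ht : 0 < t) (h1 : Real.exp (-1) * t ≤ T)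
    (h2 : T ≤ Real.exp 1 * t) (p : ℝ) :
    1 ≤ Real.exp |p| * (t / τ) ^ (-p) * (T / τ) ^ p := by
  have hT : 0 < T := (by positivity : 0 < Real.exp (-1) * t).trans_le h1
  have hu : |Real.log (T / τ) - Real.log (t / τ)| ≤ 1 := by
    rw [Real.log_div hT.ne' hτ.ne', Real.log_div ht.ne' hτ.ne', abs_le]
    have l1 := Real.log_le_log (by positivity) h1
    have l2 := Real.log_le_log hT h2
    rw [Real.log_mul (Real.exp_pos _).ne' ht.ne', Real.log_exp] at l1 l2
    constructor <;> linarith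
  rw [Real.rpow_def_of_pos (by positivity), Real.rpow_def_of_pos (by positivity), ← Real.exp_add,
    ← Real.exp_add]
  refine Real.one_le_exp ?_
  have h3 : |(Real.log (T / τ) - Real.log (t / τ)) * p| ≤ |p| := by
    rw [abs_mul]
    exact mul_le_of_le_one_left (abs_nonneg p) hu
  linarith [neg_abs_le ((Real.log (T / τ) - Real.log (t / τ)) * p)]

theorem sum_flowDeriv_sq_le (hd : 1 ≤ d) {τ : ℝ} (hτ : 0 < τ) (ℓ : ℝ) (N : ℕ)
    (f : Spacetime d → ℝ) (x : EuclideanSpace ℝ (Fin d)) {ω : EuclideanSpace ℝ (Fin d)}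
    (hω : ‖ω‖ = 1) {s : ℝ} (hs : s ∈ Set.Icc (0 : ℝ) 1) :
    ∑ k ∈ Finset.range (N + 1), flowDeriv τ x ω f k s ^ 2 ≤
      (d : ℝ) ^ N * (Real.exp |ℓ - 1| * ((lift τ x).1 / τ) ^ (1 - ℓ)) *
        energyDensity τ ℓ N f (x + flowRadius (lift τ x).1 (inner ℝ x ω) s • ω) := by
  have hd' : (1 : ℝ) ≤ d := by exact_mod_cast hd
  have hb := abs_inner_le_lift (x := x) hτ hω
  have hw := one_le_exp_mul_rpow hτ (lift_fst_pos hτ x) (le_flowTime hb hs) (flowTime_le hb hs)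
    (ℓ - 1)
  rw [neg_sub] at hw
  have hflow := flow_eq_lift (x := x) hτ hω hs
  unfold energyDensity
  rw [← hflow]
  change 1 ≤ _ * ((flow τ x ω s).1 / τ) ^ (ℓ - 1) at hw
  set S : ℝ := ∑ k ∈ Finset.range (N + 1), ∑ α : Fin k → Fin d,
    |iterBoost k α f (flow τ x ω s)| ^ 2 with hS
  have hS0 : 0 ≤ S := Finset.sum_nonneg fun k _ => Finset.sum_nonneg fun α _ => sq_nonneg _
  have hle : ∑ k ∈ Finset.range (N + 1), flowDeriv τ x ω f k s ^ 2 ≤ (d : ℝ) ^ N * S := by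
    rw [hS, Finset.mul_sum]
    refine Finset.sum_le_sum fun k hk => (flowDeriv_sq_le τ x hω f k s).trans ?_
    exact mul_le_mul_of_nonneg_right
      (pow_le_pow_right₀ hd' (by have := Finset.mem_range.1 hk; omega))
      (Finset.sum_nonneg fun α _ => sq_nonneg _)
  refine hle.trans ?_
  have := mul_le_mul_of_nonneg_left hw (by positivity : 0 ≤ (d : ℝ) ^ N * S)
  linarith

/-- The Sobolev inequality along the flow of `∑ ωⁱ Lⁱ`. -/
theorem exists_sq_le_lintegral_ray (hd : 1 ≤ d) (ℓ : ℝ) : ∃ C : ℝ, 0 < C ∧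
    ∀ f : Spacetime d → ℝ, ContDiffOn ℝ (sobolevOrder d : ℕ) f (forwardCone d) →
    ∀ (τ : ℝ), 0 < τ → ∀ (x : EuclideanSpace ℝ (Fin d)) (ω : UnitSphere d),
      ENNReal.ofReal (f (lift τ x) ^ 2) ≤
        ENNReal.ofReal (C * ((lift τ x).1 / τ) ^ (1 - ℓ) * (1 / (lift τ x).1) ^ d) *
          ∫⁻ r in Set.Ioi (0 : ℝ), ENNReal.ofReal (r ^ (d - 1)) *
            ENNReal.ofReal (energyDensity τ ℓ (sobolevOrder d) f
              (x + r • (ω : EuclideanSpace ℝ (Fin d)))) := by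
  obtain ⟨C, hC, hCG⟩ := exists_sq_le_sum_integral (d / 2)
  have hd0 : (0 : ℝ) < d := by exact_mod_cast hd
  refine ⟨C * ((d : ℝ) ^ sobolevOrder d * Real.exp |ℓ - 1|) * Real.exp 1 ^ d, by positivity,
    fun f hf τ hτ x ω => ?_⟩
  have hω : ‖(ω : EuclideanSpace ℝ (Fin d))‖ = 1 := by simp
  set G := flowDeriv τ x (ω : EuclideanSpace ℝ (Fin d)) f with hG
  set N := sobolevOrder d with hN
  set t := (lift τ x).1 with ht
  set b := inner ℝ x (ω : EuclideanSpace ℝ (Fin d)) with hb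
  have htpos : 0 < t := lift_fst_pos hτ x
  have hcont : ∀ k ∈ Finset.range (N + 1), ContinuousOn (G k) (Set.Icc 0 1) := fun k hk =>
    continuousOn_flowDeriv hτ hω hf (by have := Finset.mem_range.1 hk; omega)
  have hG0 : G 0 0 = f (lift τ x) := by
    simp [hG, flowDeriv, iterBoost, flow_eq_lift hτ hω (Set.left_mem_Icc.2 zero_le_one), flowRadius]
  have h1 := hCG G (fun k hk s hs => hasDerivAt_flowDeriv hτ hω hf
    (by rw [hN, sobolevOrder]; omega) hs) (hcont (d / 2 + 1) (by simp [hN, sobolevOrder]))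
  change G 0 0 ^ 2 ≤ C * ∑ k ∈ Finset.range (N + 1), _ at h1
  have hint : ∀ k ∈ Finset.range (N + 1),
      ContinuousOn (fun s => s ^ (2 * (d / 2)) * G k s ^ 2) (Set.Icc 0 1) := fun k hk => by
    have := hcont k hk
    fun_prop
  rw [hG0, ← intervalIntegral.integral_finsetSum fun k hk =>
    ContinuousOn.intervalIntegrable (by rw [Set.uIcc_of_le zero_le_one]; exact hint k hk),
    intervalIntegral.integral_of_le zero_le_one] at h1
  set A : ℝ := (d : ℝ) ^ N * (Real.exp |ℓ - 1| * (t / τ) ^ (1 - ℓ)) with hA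
  have hA0 : 0 < A := by positivity
  calc ENNReal.ofReal (f (lift τ x) ^ 2)
      ≤ ENNReal.ofReal (C * ∫ s in Set.Ioc (0 : ℝ) 1,
          ∑ k ∈ Finset.range (N + 1), s ^ (2 * (d / 2)) * G k s ^ 2) := ENNReal.ofReal_le_ofReal h1
    _ = ENNReal.ofReal C * ∫⁻ s in Set.Ioc (0 : ℝ) 1, ENNReal.ofReal
          (∑ k ∈ Finset.range (N + 1), s ^ (2 * (d / 2)) * G k s ^ 2) := by
        rw [ENNReal.ofReal_mul hC.le, ofReal_integral_eq_lintegral_ofReal]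
        · exact ((continuousOn_finsetSum _ hint).integrableOn_Icc).mono_set Set.Ioc_subset_Icc_self
        · refine Filter.Eventually.of_forall fun s => Finset.sum_nonneg fun k _ => ?_
          exact mul_nonneg (by rw [pow_mul]; positivity) (sq_nonneg _)
    _ ≤ ENNReal.ofReal C * ∫⁻ s in Set.Ioc (0 : ℝ) 1, ENNReal.ofReal A *
          (ENNReal.ofReal (s ^ (d - 1)) * ENNReal.ofReal (energyDensity τ ℓ N f
            (x + flowRadius t b s • (ω : EuclideanSpace ℝ (Fin d))))) := by
        refine mul_le_mul_right (setLIntegral_mono' measurableSet_Ioc fun s hs => ?_) _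
        have hs0 : 0 ≤ s ^ (d - 1) := pow_nonneg hs.1.le _
        rw [← ENNReal.ofReal_mul hs0, ← ENNReal.ofReal_mul hA0.le, ← Finset.mul_sum]
        refine ENNReal.ofReal_le_ofReal ?_
        have h2 := sum_flowDeriv_sq_le hd hτ ℓ N f x hω (Set.Ioc_subset_Icc_self hs)
        -- Here `s ≤ 1` and `2⌊d/2⌋ ≥ d - 1`; this inequality allows `⌊d/2⌋ + 1` derivatives.
        have h3 : s ^ (2 * (d / 2)) ≤ s ^ (d - 1) :=
          pow_le_pow_of_le_one hs.1.le hs.2 (by omega)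
        calc _ ≤ s ^ (d - 1) * _ := mul_le_mul h3 h2
              (Finset.sum_nonneg fun k _ => sq_nonneg _) hs0
          _ = _ := by ring
    _ ≤ ENNReal.ofReal C * (ENNReal.ofReal A * (ENNReal.ofReal ((Real.exp 1 / t) ^ (d - 1 + 1)) *
          ∫⁻ r in Set.Ioi (0 : ℝ), ENNReal.ofReal (r ^ (d - 1)) *
            ENNReal.ofReal (energyDensity τ ℓ N f
              (x + r • (ω : EuclideanSpace ℝ (Fin d)))))) := by
        rw [lintegral_const_mul' _ _ ENNReal.ofReal_ne_top]
        refine mul_le_mul_right (mul_le_mul_right ?_ _) _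
        exact setLIntegral_flowRadius_le (d - 1) htpos (abs_inner_le_lift hτ hω) fun r =>
          ENNReal.ofReal (energyDensity τ ℓ N f (x + r • (ω : EuclideanSpace ℝ (Fin d))))
    _ = _ := by
        rw [← mul_assoc, ← mul_assoc, ← ENNReal.ofReal_mul hC.le, ← ENNReal.ofReal_mul (by positivity),
          Nat.sub_add_cancel hd, hA]
        congr 2
        rw [div_pow, one_div, inv_pow]
        ring

/-- The Sobolev inequality on the hyperboloid in the coordinates `x`. -/
theorem exists_sq_le_lintegral_energyDensity (hd : 1 ≤ d) (ℓ : ℝ) : ∃ C : ℝ, 0 < C ∧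
    ∀ f : Spacetime d → ℝ, ContDiffOn ℝ (sobolevOrder d : ℕ) f (forwardCone d) →
    ∀ (τ : ℝ), 0 < τ → ∀ x : EuclideanSpace ℝ (Fin d),
      ENNReal.ofReal (f (lift τ x) ^ 2) ≤
        ENNReal.ofReal (C * ((lift τ x).1 / τ) ^ (1 - ℓ) * (1 / (lift τ x).1) ^ d) *
          ∫⁻ y, ENNReal.ofReal (energyDensity τ ℓ (sobolevOrder d) f y) := by
  obtain ⟨C, hC, hray⟩ := exists_sq_le_lintegral_ray hd ℓ
  have : Nonempty (Fin d) := ⟨⟨0, hd⟩⟩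
  set σ := (volume : Measure (EuclideanSpace ℝ (Fin d))).toSphere with hσ
  have hσpos : 0 < σ.real Set.univ :=
    ENNReal.toReal_pos (Measure.measure_univ_ne_zero.2 (Measure.toSphere_ne_zero _))
      (measure_ne_top _ _)
  refine ⟨C / σ.real Set.univ, by positivity, fun f hf τ hτ x => ?_⟩
  have ht := lift_fst_pos hτ x
  have hm := (measurable_energyDensity hτ ℓ hf).ennreal_ofReal
  -- The left side does not depend on `ω`, so integrating over the sphere gives it times the total
  -- area; on the right, polar coordinates and translation invariance remove the base point `x`.
  have hint := lintegral_mono (μ := σ) fun ω => hray f hf τ hτ x ω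
  rw [lintegral_const, lintegral_const_mul' _ _ ENNReal.ofReal_ne_top,
    ← lintegral_eq_lintegral_sphere_lintegral_Ioi hd
      (F := fun y => ENNReal.ofReal (energyDensity τ ℓ (sobolevOrder d) f (x + y)))
      (hm.comp (measurable_const_add x)),
    lintegral_add_left_eq_self
      (fun y => ENNReal.ofReal (energyDensity τ ℓ (sobolevOrder d) f y)) x,
    ← ofReal_measureReal (measure_ne_top σ _)] at hint
  have hcancel : ENNReal.ofReal (σ.real Set.univ)⁻¹ * ENNReal.ofReal (σ.real Set.univ) = 1 := by
    rw [← ENNReal.ofReal_mul (by positivity), inv_mul_cancel₀ hσpos.ne', ENNReal.ofReal_one]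
  calc ENNReal.ofReal (f (lift τ x) ^ 2)
      = ENNReal.ofReal (σ.real Set.univ)⁻¹ *
          (ENNReal.ofReal (f (lift τ x) ^ 2) * ENNReal.ofReal (σ.real Set.univ)) := by
        rw [mul_comm (ENNReal.ofReal (f (lift τ x) ^ 2)), ← mul_assoc, hcancel, one_mul]
    _ ≤ _ := mul_le_mul_right hint _
    _ = _ := by
        rw [← mul_assoc, ← ENNReal.ofReal_mul (by positivity)]
        congr 2
        ring

end Sobolev

end LorentzBoost

/-! ### Return to hyperboloidal coordinates -/

theorem mainTheorem2 (d : ℕ) (hd : 1 ≤ d) (ℓ : ℝ) :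
    ∃ C : ℝ, 0 < C ∧
      ∀ f : LorentzBoost.Spacetime d → ℝ,
        ContDiffOn ℝ (LorentzBoost.sobolevOrder d : ℕ) f (LorentzBoost.forwardCone d) →
        ∀ (τ ρ : ℝ) (θ : LorentzBoost.UnitSphere d), 0 < τ → 0 ≤ ρ →
          ENNReal.ofReal (|f (LorentzBoost.hypPoint τ ρ θ)| ^ 2) ≤
            ENNReal.ofReal (C * τ ^ (-(d : ℝ)) * Real.cosh ρ ^ (1 - (d : ℝ) - ℓ)) *
              ∑ m ∈ Finset.range (LorentzBoost.sobolevOrder d + 1), ∑ α : Fin m → Fin d,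
                LorentzBoost.hyperboloidIntegral τ (fun ρ' (θ' : LorentzBoost.UnitSphere d) =>
                  ENNReal.ofReal (Real.cosh ρ' ^ ℓ *
                    |LorentzBoost.iterBoost m α f (LorentzBoost.hypPoint τ ρ' θ')| ^ 2)) := by
  obtain ⟨C, hC, hmain⟩ := LorentzBoost.exists_sq_le_lintegral_energyDensity hd ℓ
  refine ⟨C, hC, fun f hf τ ρ θ hτ _ => ?_⟩
  have h := hmain f hf τ hτ ((τ * Real.sinh ρ) • (θ : EuclideanSpace ℝ (Fin d)))
  rw [LorentzBoost.lintegral_energyDensity hd hτ ℓ hf, LorentzBoost.lift_sinh_smul hτ] at h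
  rw [sq_abs]
  refine h.trans_eq ?_
  congr 2
  have hch := Real.cosh_pos ρ
  have h1 : (LorentzBoost.hypPoint τ ρ θ).1 = τ * Real.cosh ρ := rfl
  -- With `t = τ cosh ρ`, the prefactor is `cosh ρ ^ (1 - ℓ) (τ cosh ρ) ^ (-d)`.
  rw [h1, mul_div_cancel_left₀ _ hτ.ne', show (1 : ℝ) - d - ℓ = 1 - ℓ - d by ring,
    Real.rpow_sub_natCast hch.ne', Real.rpow_neg hτ.le, Real.rpow_natCast, one_div, inv_pow,
    mul_pow, mul_inv]
  ring
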